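/- Let $K$ be an arbitrary field and $R = K[x,y,z]$ with its standard grading. A standard graded Artinian $K$-algebra $A$ has the weak Lefschetz property (WLP) if there is a linear form $L \in A_1$ such that, for every integer $j$, the multiplication map $\times L : A_{j-1} \to A_j$ is injective or surjective. Let $\alpha,\beta,\gamma,t$ be integers with $1 \le \alpha \le \beta \le \gamma$, and let $$I = (x^{\alpha+t},\, y^{\beta+t},\, z^{\gamma+t},\, x^\alpha y^\beta z^\gamma) \subset R.$$ Assume that one of the following holds: 1. $\alpha = \beta$ is even and $\gamma = \alpha + 3\lambda$ for an odd integer $\lambda$ with $1 \le \lambda \le \alpha$, and $t$ is even with $t \ge \alpha + \lambda$; 2. $\alpha = \beta$ is odd and $\gamma = \alpha + 6\mu$ for an integer $\mu$ with $0 \le \mu \le \frac{\alpha-1}{2}$, and $t$ is even with $t \ge \alpha + 2\mu$; 3. $\alpha$ is odd and $\beta = \gamma = \alpha + 3\rho$ for an integer $\rho \ge 0$, and $t$ is even with $t \ge \alpha + 2\rho$. Then $R/I$ fails to have the WLP. -/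

import Mathlib

open MvPolynomial

/-- The degree `d` component `(R/I)_d` of `R/I`, where `R = K[x_i : i ∈ σ]` has its standard
grading: the image in `R/I` of the space of homogeneous polynomials of degree `d`.
For a homogeneous ideal `I` these are the graded components of the graded algebra `R/I`. -/
noncomputable def gradedPiece {σ K : Type*} [Field K] (I : Ideal (MvPolynomial σ K)) (d : ℕ) :
    Submodule K (MvPolynomial σ K ⧸ I) :=
  (homogeneousSubmodule σ K d).map (Ideal.Quotient.mkₐ K I).toLinearMap

/-- The weak Lefschetz property of `R/I` (`I` a homogeneous ideal with `R/I` Artinian): there is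
a linear form `L ∈ (R/I)_1` such that every multiplication map `×L : (R/I)_j → (R/I)_{j+1}` has
maximal rank, i.e. is injective or surjective. Negative `j` need no mention, since then
`(R/I)_j = 0`. -/
def HasWLP {σ K : Type*} [Field K] (I : Ideal (MvPolynomial σ K)) : Prop :=
  ∃ L ∈ gradedPiece I 1, ∀ j : ℕ,
    Set.InjOn (fun a => L * a) (gradedPiece I j : Set (MvPolynomial σ K ⧸ I)) ∨
    Set.SurjOn (fun a => L * a) (gradedPiece I j : Set (MvPolynomial σ K ⧸ I))
      (gradedPiece I (j + 1) : Set (MvPolynomial σ K ⧸ I))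

/-- The ideal `(x^(α+t), y^(β+t), z^(γ+t), x^α y^β z^γ)` of `K[x, y, z]`. -/
noncomputable def levelIdeal (K : Type*) [Field K] (α β γ t : ℕ) :
    Ideal (MvPolynomial (Fin 3) K) :=
  Ideal.span {X 0 ^ (α + t), X 1 ^ (β + t), X 2 ^ (γ + t), X 0 ^ α * X 1 ^ β * X 2 ^ γ}

/-!
In all three families two of the exponents `α`, `β`, `γ` are equal, say to `a`, and the third one,
`g`, satisfies `2 * a + g = 3 * s` with `s` odd, while `t` is even with `t > s` and `g < 2 * s`. Let
`u`, `v` be the variables with equal exponents and `w` the third one. Put `j = 2 * s + t - 2`.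

The components of degree `j` and `j + 1` of the quotient have the same dimension
(`card_survivors_eq`), so a linear form `L` has maximal rank there only if it acts injectively
(`eq_zero_of_mul_eq_zero`). For `L = X u + X v + X w` this is impossible: `L` is invariant under the
exchange of `u` and `v`, so it maps the span of the orbit sums of monomials of degree `j` to the
span of those of degree `j + 1`, and by parity there is one orbit more in degree `j` than in degree
`j + 1` (`card_survivorOrbits_eq`). Orbit sums are independent in every characteristic, so the field
does not matter.

For an arbitrary form `L = b X u + c X v + d X w` with `b` or `c` nonzero the same argument works
with orbit sums twisted by powers of `b` and `c` (`orbitSum`): they remain independent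
(`orbitClass_linearIndependent`), and `L` maps their span to the corresponding span in the next
degree (`mul_orbitClass_mem_span`). If `b = c = 0`, then `L` kills the nonzero class of
`X u ^ (2 * s - g - 1) * X w ^ (g + t - 1)`, which has degree `j`.

Both counts compare degrees `j` and `j + 1` through multiplication by `X w`
(`card_add_card_filter_last_eq`), which leaves only one-parameter sets of monomials to be counted.
-/

/-! ### Counting monomials and orbits -/

/-- The monomial `X u ^ p * X v ^ q * X w ^ r` lies outside the ideal
`(X u ^ (a + t), X v ^ (a + t), X w ^ (g + t), X u ^ a * X v ^ a * X w ^ g)`. -/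
def Survives (a g t p q r : ℕ) : Prop :=
  p < a + t ∧ q < a + t ∧ r < g + t ∧ (p < a ∨ q < a ∨ r < g)

instance (a g t p q r : ℕ) : Decidable (Survives a g t p q r) := by
  unfold Survives; infer_instance

/-- The triples with entries at most `n`, a finite set containing the exponents of all monomials of
degree `n`. -/
def cube (n : ℕ) : Finset (ℕ × ℕ × ℕ) :=
  Finset.range (n + 1) ×ˢ Finset.range (n + 1) ×ˢ Finset.range (n + 1)

/-- The exponents `(p, q, r)` of the monomials of degree `n` outside the ideal: they index a basis
of the degree `n` component of the quotient. -/
def survivors (a g t n : ℕ) : Finset (ℕ × ℕ × ℕ) :=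
  (cube n).filter fun m => m.1 + m.2.1 + m.2.2 = n ∧ Survives a g t m.1 m.2.1 m.2.2

/-- The orbits of `survivors a g t n` under exchange of the first two exponents. The triple
`(q, k, r)` stands for the orbit of `(q + k, q, r)`, so that `k` is the (nonnegative) difference of
the two exchanged exponents. -/
def survivorOrbits (a g t n : ℕ) : Finset (ℕ × ℕ × ℕ) :=
  (cube n).filter fun m =>
    2 * m.1 + m.2.1 + m.2.2 = n ∧ Survives a g t (m.1 + m.2.1) m.1 m.2.2

theorem mem_survivors {a g t n p q r : ℕ} :
    (p, q, r) ∈ survivors a g t n ↔ p + q + r = n ∧ Survives a g t p q r := by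
  simp only [survivors, cube, Finset.mem_filter, Finset.mem_product, Finset.mem_range]
  constructor
  · exact fun h => h.2
  · exact fun h => ⟨by omega, h⟩

theorem mem_survivorOrbits {a g t n q k r : ℕ} :
    (q, k, r) ∈ survivorOrbits a g t n ↔ 2 * q + k + r = n ∧ Survives a g t (q + k) q r := by
  simp only [survivorOrbits, cube, Finset.mem_filter, Finset.mem_product, Finset.mem_range]
  constructor
  · exact fun h => h.2
  · exact fun h => ⟨by omega, h⟩

/-- Raising the last entry by one is a bijection from the elements of `S` that it takes into `T`
onto the elements of `T` with nonzero last entry. So the sizes of `S` and `T` can be compared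
through the elements left out, which have only one degree of freedom. -/
theorem card_add_card_filter_last_eq (S T : Finset (ℕ × ℕ × ℕ))
    (h : ∀ i j r, (i, j, r + 1) ∈ T → (i, j, r) ∈ S) :
    T.card + (S.filter fun m => (m.1, m.2.1, m.2.2 + 1) ∉ T).card =
      S.card + (T.filter fun m => m.2.2 = 0).card := by
  have hbij : (S.filter fun m => (m.1, m.2.1, m.2.2 + 1) ∈ T).card =
      (T.filter fun m => ¬ m.2.2 = 0).card := by
    refine Finset.card_nbij' (fun m => (m.1, m.2.1, m.2.2 + 1))
      (fun m => (m.1, m.2.1, m.2.2 - 1)) ?_ ?_ ?_ ?_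
    · rintro ⟨i, j, r⟩ hm
      simpa using (Finset.mem_filter.1 hm).2
    · rintro ⟨i, j, r⟩ hm
      obtain ⟨hm, hr⟩ := Finset.mem_filter.1 hm
      obtain ⟨r, rfl⟩ := Nat.exists_eq_succ_of_ne_zero hr
      exact Finset.mem_filter.2 ⟨h _ _ _ hm, hm⟩
    · rintro ⟨i, j, r⟩ _
      simp
    · rintro ⟨i, j, r⟩ hm
      have hr : r ≠ 0 := (Finset.mem_filter.1 hm).2
      simp only [Prod.mk.injEq, true_and]
      omega
  have hS := Finset.card_filter_add_card_filter_not (s := S)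
    (fun m => (m.1, m.2.1, m.2.2 + 1) ∈ T)
  have hT := Finset.card_filter_add_card_filter_not (s := T) (fun m => m.2.2 = 0)
  omega

/-- Multiplication by the third variable takes a surviving monomial of degree `2 * s + t - 2` into
the ideal exactly if it hits the generator `X w ^ (g + t)` or the mixed generator; the degree is too
small for both to happen at once. -/
theorem mem_survivors_filter_notMem {a g t s : ℕ} (hg : 1 ≤ g)
    (hs : 3 * s = 2 * a + g) (hgs : g < 2 * s) (hst : s < t) {m : ℕ × ℕ × ℕ} :
    (m ∈ (survivors a g t (2 * s + t - 2)).filter fun m =>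
      (m.1, m.2.1, m.2.2 + 1) ∉ survivors a g t (2 * s + t - 1)) ↔
    (m.2.2 = g + t - 1 ∧ m.1 + m.2.1 = 2 * s - g - 1) ∨
      (m.2.2 = g - 1 ∧ a ≤ m.1 ∧ a ≤ m.2.1 ∧ m.1 + m.2.1 = 2 * a + (t - s - 1)) := by
  obtain ⟨p, q, r⟩ := m
  rw [Finset.mem_filter, mem_survivors]
  dsimp only
  rw [mem_survivors]
  unfold Survives
  constructor
  · rintro ⟨⟨hn, hp, hq, hr, h⟩, h'⟩
    by_cases hr' : r + 1 < g + t
    · have : a ≤ p ∧ a ≤ q ∧ g ≤ r + 1 := by omega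
      omega
    · omega
  · rintro (⟨hr, h⟩ | ⟨hr, h⟩)
    · refine ⟨⟨by omega, by omega, by omega, by omega, ?_⟩, by omega⟩
      by_contra h'
      have : a ≤ p ∧ a ≤ q := by omega
      omega
    · exact ⟨⟨by omega, by omega, by omega, by omega, by omega⟩, by omega⟩

/-- The quotient has equal dimensions in the degrees `2 * s + t - 2` and `2 * s + t - 1`. -/
theorem card_survivors_eq {a g t s : ℕ} (ha : 1 ≤ a) (hg : 1 ≤ g) (hs : 3 * s = 2 * a + g)
    (hgs : g < 2 * s) (hst : s < t) :
    (survivors a g t (2 * s + t - 2)).card = (survivors a g t (2 * s + t - 1)).card := by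
  have key := card_add_card_filter_last_eq (survivors a g t (2 * s + t - 2))
    (survivors a g t (2 * s + t - 1)) (by
      intro p q r h
      rw [mem_survivors] at h ⊢
      unfold Survives at *
      omega)
  have h0 : ((survivors a g t (2 * s + t - 1)).filter fun m => m.2.2 = 0).card =
      2 * a + t - 2 * s := by
    rw [← Finset.card_range (2 * a + t - 2 * s)]
    symm
    refine Finset.card_nbij' (fun i => (2 * s - a + i, a + t - 1 - i, 0))
      (fun m => m.1 - (2 * s - a)) ?_ ?_ ?_ ?_
    · intro i hi
      have hi := Finset.mem_range.1 hi
      refine Finset.mem_filter.2 ⟨mem_survivors.2 ?_, rfl⟩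
      unfold Survives
      omega
    · rintro ⟨p, q, r⟩ hm
      obtain ⟨hm, hr : r = 0⟩ := Finset.mem_filter.1 hm
      rw [mem_survivors] at hm
      unfold Survives at hm
      refine Finset.mem_range.2 ?_
      dsimp only
      omega
    · intro i hi
      dsimp only
      omega
    · rintro ⟨p, q, r⟩ hm
      obtain ⟨hm, hr : r = 0⟩ := Finset.mem_filter.1 hm
      rw [mem_survivors] at hm
      unfold Survives at hm
      simp only [Prod.mk.injEq]
      omega
  have h1 : ((survivors a g t (2 * s + t - 2)).filter fun m =>
      (m.1, m.2.1, m.2.2 + 1) ∉ survivors a g t (2 * s + t - 1)).card =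
      (2 * s - g) + (t - s) := by
    rw [← Finset.card_range ((2 * s - g) + (t - s))]
    symm
    refine Finset.card_nbij'
      (fun i => if i < 2 * s - g then (i, 2 * s - g - 1 - i, g + t - 1)
        else (a + (i - (2 * s - g)), a + (t - s - 1) - (i - (2 * s - g)), g - 1))
      (fun m => if m.2.2 = g - 1 then (2 * s - g) + (m.1 - a) else m.1) ?_ ?_ ?_ ?_
    · intro i hi
      have hi := Finset.mem_range.1 hi
      refine (mem_survivors_filter_notMem hg hs hgs hst).2 ?_
      dsimp only
      split_ifs with h
      · exact Or.inl ⟨rfl, by dsimp only; omega⟩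
      · exact Or.inr ⟨rfl, by dsimp only; omega⟩
    · rintro ⟨p, q, r⟩ hm
      refine Finset.mem_range.2 ?_
      dsimp only
      rcases (mem_survivors_filter_notMem hg hs hgs hst).1 hm with
        ⟨hr, hm⟩ | ⟨hr, hm⟩ <;> dsimp only at hr hm
      · rw [if_neg (by omega : ¬ r = g - 1)]
        omega
      · rw [if_pos hr]
        omega
    · intro i hi
      have hi := Finset.mem_range.1 hi
      dsimp only
      by_cases h : i < 2 * s - g
      · rw [if_pos h, if_neg (by dsimp only; omega)]
      · rw [if_neg h, if_pos rfl]
        dsimp only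
        omega
    · rintro ⟨p, q, r⟩ hm
      dsimp only
      rcases (mem_survivors_filter_notMem hg hs hgs hst).1 hm with
        ⟨hr, hm⟩ | ⟨hr, hm⟩ <;> dsimp only at hr hm
      · rw [if_neg (by omega : ¬ r = g - 1), if_pos (by omega)]
        rw [Prod.mk.injEq, Prod.mk.injEq]
        exact ⟨by omega, by omega, by omega⟩
      · rw [if_pos hr, if_neg (by omega)]
        rw [Prod.mk.injEq, Prod.mk.injEq]
        exact ⟨by omega, by omega, by omega⟩
  omega

theorem mem_survivorOrbits_filter_notMem {a g t s : ℕ} (hg : 1 ≤ g)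
    (hs : 3 * s = 2 * a + g) (hgs : g < 2 * s) (hst : s < t) {m : ℕ × ℕ × ℕ} :
    (m ∈ (survivorOrbits a g t (2 * s + t - 2)).filter fun m =>
      (m.1, m.2.1, m.2.2 + 1) ∉ survivorOrbits a g t (2 * s + t - 1)) ↔
    (m.2.2 = g + t - 1 ∧ 2 * m.1 + m.2.1 = 2 * s - g - 1) ∨
      (m.2.2 = g - 1 ∧ a ≤ m.1 ∧ 2 * m.1 + m.2.1 = 2 * a + (t - s - 1)) := by
  obtain ⟨p, q, r⟩ := m
  rw [Finset.mem_filter, mem_survivorOrbits]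
  dsimp only
  rw [mem_survivorOrbits]
  unfold Survives
  constructor
  · rintro ⟨⟨hn, hp, hq, hr, h⟩, h'⟩
    by_cases hr' : r + 1 < g + t
    · have : a ≤ p ∧ g ≤ r + 1 := by omega
      omega
    · omega
  · rintro (⟨hr, h⟩ | ⟨hr, h⟩)
    · refine ⟨⟨by omega, by omega, by omega, by omega, ?_⟩, by omega⟩
      by_contra h'
      have : a ≤ p ∧ a ≤ q := by omega
      omega
    · exact ⟨⟨by omega, by omega, by omega, by omega, by omega⟩, by omega⟩

/-- Parity makes the number of orbits drop by one between the two degrees of equal dimension. -/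
theorem card_survivorOrbits_eq {a g t s : ℕ} (ha : 1 ≤ a) (hg : 1 ≤ g)
    (hs : 3 * s = 2 * a + g) (hgs : g < 2 * s) (hst : s < t) (hsodd : Odd s) (ht : Even t) :
    (survivorOrbits a g t (2 * s + t - 2)).card =
      (survivorOrbits a g t (2 * s + t - 1)).card + 1 := by
  obtain ⟨e, he⟩ := hsodd
  obtain ⟨τ, hτ⟩ := ht
  have key := card_add_card_filter_last_eq (survivorOrbits a g t (2 * s + t - 2))
    (survivorOrbits a g t (2 * s + t - 1)) (by
      intro p q r h
      rw [mem_survivorOrbits] at h ⊢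
      unfold Survives at *
      omega)
  have h0 : ((survivorOrbits a g t (2 * s + t - 1)).filter fun m => m.2.2 = 0).card =
      a + τ - s := by
    rw [← Finset.card_range (a + τ - s)]
    symm
    refine Finset.card_nbij' (fun i => (2 * s - a + i, 2 * (a + τ - s - 1 - i) + 1, 0))
      (fun m => m.1 - (2 * s - a)) ?_ ?_ ?_ ?_
    · intro i hi
      have hi := Finset.mem_range.1 hi
      refine Finset.mem_filter.2 ⟨mem_survivorOrbits.2 ?_, rfl⟩
      unfold Survives
      omega
    · rintro ⟨p, q, r⟩ hm
      obtain ⟨hm, hr : r = 0⟩ := Finset.mem_filter.1 hm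
      rw [mem_survivorOrbits] at hm
      unfold Survives at hm
      refine Finset.mem_range.2 ?_
      dsimp only
      omega
    · intro i hi
      dsimp only
      omega
    · rintro ⟨p, q, r⟩ hm
      obtain ⟨hm, hr : r = 0⟩ := Finset.mem_filter.1 hm
      rw [mem_survivorOrbits] at hm
      unfold Survives at hm
      simp only [Prod.mk.injEq]
      omega
  -- `g` is odd like `s`, and `t` is even.
  obtain ⟨x, hx⟩ : ∃ x, 2 * s - g = 2 * x + 1 := ⟨(2 * s - g) / 2, by omega⟩
  obtain ⟨y, hy⟩ : ∃ y, t - s = 2 * y + 1 := ⟨(t - s) / 2, by omega⟩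
  have h1 : ((survivorOrbits a g t (2 * s + t - 2)).filter fun m =>
      (m.1, m.2.1, m.2.2 + 1) ∉ survivorOrbits a g t (2 * s + t - 1)).card =
      (x + 1) + (y + 1) := by
    rw [← Finset.card_range ((x + 1) + (y + 1))]
    symm
    refine Finset.card_nbij'
      (fun i => if i < x + 1 then (i, 2 * (x - i), g + t - 1)
        else (a + (i - (x + 1)), 2 * (y - (i - (x + 1))), g - 1))
      (fun m => if m.2.2 = g - 1 then (x + 1) + (m.1 - a) else m.1) ?_ ?_ ?_ ?_
    · intro i hi
      have hi := Finset.mem_range.1 hi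
      refine (mem_survivorOrbits_filter_notMem hg hs hgs hst).2 ?_
      dsimp only
      split_ifs with h
      · exact Or.inl ⟨rfl, by dsimp only; omega⟩
      · exact Or.inr ⟨rfl, by dsimp only; omega⟩
    · rintro ⟨p, q, r⟩ hm
      refine Finset.mem_range.2 ?_
      dsimp only
      rcases (mem_survivorOrbits_filter_notMem hg hs hgs hst).1 hm with
        ⟨hr, hm⟩ | ⟨hr, hm⟩ <;> dsimp only at hr hm
      · rw [if_neg (by omega : ¬ r = g - 1)]
        omega
      · rw [if_pos hr]
        omega
    · intro i hi
      have hi := Finset.mem_range.1 hi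
      dsimp only
      by_cases h : i < x + 1
      · rw [if_pos h, if_neg (by dsimp only; omega)]
      · rw [if_neg h, if_pos rfl]
        dsimp only
        omega
    · rintro ⟨p, q, r⟩ hm
      dsimp only
      rcases (mem_survivorOrbits_filter_notMem hg hs hgs hst).1 hm with
        ⟨hr, hm⟩ | ⟨hr, hm⟩ <;> dsimp only at hr hm
      · rw [if_neg (by omega : ¬ r = g - 1), if_pos (by omega)]
        rw [Prod.mk.injEq, Prod.mk.injEq]
        exact ⟨by omega, by omega, by omega⟩
      · rw [if_pos hr, if_neg (by omega)]
        rw [Prod.mk.injEq, Prod.mk.injEq]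
        exact ⟨by omega, by omega, by omega⟩
  omega

/-! ### Membership in the monomial ideal -/

/-- The exponent vector of `X u ^ p * X v ^ q * X w ^ r`, for `m = (p, q, r)`. -/
noncomputable def exponent (u v w : Fin 3) (m : ℕ × ℕ × ℕ) : Fin 3 →₀ ℕ :=
  Finsupp.single u m.1 + Finsupp.single v m.2.1 + Finsupp.single w m.2.2

/-- `u`, `v`, `w` are the three variables, in some order. -/
structure AreDistinct (u v w : Fin 3) : Prop where
  uv : u ≠ v
  uw : u ≠ w
  vw : v ≠ w

theorem AreDistinct.eq_or {u v w : Fin 3} (h : AreDistinct u v w) (i : Fin 3) :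
    i = u ∨ i = v ∨ i = w := by
  obtain ⟨h1, h2, h3⟩ := h
  revert u v w i
  decide

theorem exponent_apply_fst {u v w : Fin 3} (h : AreDistinct u v w)
    (m : ℕ × ℕ × ℕ) : exponent u v w m u = m.1 := by
  simp [exponent, h.uv.symm, h.uw.symm]

theorem exponent_apply_snd {u v w : Fin 3} (h : AreDistinct u v w)
    (m : ℕ × ℕ × ℕ) : exponent u v w m v = m.2.1 := by
  simp [exponent, h.uv, h.vw.symm]

theorem exponent_apply_trd {u v w : Fin 3} (h : AreDistinct u v w)
    (m : ℕ × ℕ × ℕ) : exponent u v w m w = m.2.2 := by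
  simp [exponent, h.uw, h.vw]

theorem exponent_injective {u v w : Fin 3} (h : AreDistinct u v w) :
    Function.Injective (exponent u v w) := by
  rintro m m' e
  have h1 := DFunLike.congr_fun e u
  have h2 := DFunLike.congr_fun e v
  have h3 := DFunLike.congr_fun e w
  rw [exponent_apply_fst h, exponent_apply_fst h] at h1
  rw [exponent_apply_snd h, exponent_apply_snd h] at h2
  rw [exponent_apply_trd h, exponent_apply_trd h] at h3
  exact Prod.ext h1 (Prod.ext h2 h3)

theorem exponent_surjective {u v w : Fin 3} (h : AreDistinct u v w) :
    Function.Surjective (exponent u v w) := by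
  intro d
  refine ⟨(d u, d v, d w), ?_⟩
  ext i
  rcases h.eq_or i with rfl | rfl | rfl
  · rw [exponent_apply_fst h]
  · rw [exponent_apply_snd h]
  · rw [exponent_apply_trd h]

theorem degree_exponent (u v w : Fin 3) (m : ℕ × ℕ × ℕ) :
    (exponent u v w m).degree = m.1 + m.2.1 + m.2.2 := by
  simp [exponent, Finsupp.degree_single]

/-- The ideal with equal exponents in the variables `u` and `v`. The order of the variables is left
free, since the two equal exponents may be the smaller or the larger ones. -/
noncomputable def symIdeal (K : Type*) [Field K] (u v w : Fin 3) (a g t : ℕ) :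
    Ideal (MvPolynomial (Fin 3) K) :=
  Ideal.span {X u ^ (a + t), X v ^ (a + t), X w ^ (g + t), X u ^ a * X v ^ a * X w ^ g}

section

variable {K : Type*} [Field K] {u v w : Fin 3} {a g t : ℕ}

theorem symIdeal_eq_span_monomial :
    symIdeal K u v w a g t = Ideal.span ((fun d => monomial d (1 : K)) ''
      (exponent u v w '' {(a + t, 0, 0), (0, a + t, 0), (0, 0, g + t), (a, a, g)})) := by
  rw [symIdeal]
  congr 1
  simp only [Set.image_insert_eq, Set.image_singleton, exponent, X_pow_eq_monomial, monomial_mul,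
    mul_one, Finsupp.single_zero, add_zero, zero_add]

theorem exponent_le_iff (h : AreDistinct u v w) (m m' : ℕ × ℕ × ℕ) :
    exponent u v w m ≤ exponent u v w m' ↔ m.1 ≤ m'.1 ∧ m.2.1 ≤ m'.2.1 ∧ m.2.2 ≤ m'.2.2 := by
  constructor
  · intro hle
    have h1 := hle u
    have h2 := hle v
    have h3 := hle w
    rw [exponent_apply_fst h, exponent_apply_fst h] at h1
    rw [exponent_apply_snd h, exponent_apply_snd h] at h2
    rw [exponent_apply_trd h, exponent_apply_trd h] at h3
    exact ⟨h1, h2, h3⟩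
  · rintro ⟨h1, h2, h3⟩ i
    rcases h.eq_or i with rfl | rfl | rfl
    · rwa [exponent_apply_fst h, exponent_apply_fst h]
    · rwa [exponent_apply_snd h, exponent_apply_snd h]
    · rwa [exponent_apply_trd h, exponent_apply_trd h]

/-- A polynomial lies in the monomial ideal exactly if no surviving monomial occurs in it. -/
theorem mem_symIdeal_iff (h : AreDistinct u v w) (f : MvPolynomial (Fin 3) K) :
    f ∈ symIdeal K u v w a g t ↔
      ∀ m : ℕ × ℕ × ℕ, coeff (exponent u v w m) f ≠ 0 →
        ¬ Survives a g t m.1 m.2.1 m.2.2 := by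
  have key : ∀ m : ℕ × ℕ × ℕ, (∃ d ∈ exponent u v w ''
      {(a + t, 0, 0), (0, a + t, 0), (0, 0, g + t), (a, a, g)}, d ≤ exponent u v w m) ↔
      ¬ Survives a g t m.1 m.2.1 m.2.2 := by
    intro m
    simp only [Set.exists_mem_image, Set.mem_insert_iff, Set.mem_singleton_iff, exists_eq_or_imp,
      exists_eq_left, exponent_le_iff h, Survives]
    omega
  rw [symIdeal_eq_span_monomial, mem_ideal_span_monomial_image]
  constructor
  · exact fun hf m hm => (key m).1 (hf _ (mem_support_iff.2 hm))
  · intro hf d hd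
    obtain ⟨m, rfl⟩ := exponent_surjective h d
    exact (key m).2 (hf m (mem_support_iff.1 hd))

/-- Polynomials have linearly independent classes if each contains a surviving monomial that occurs
in none of the others. -/
theorem linearIndependent_mk (h : AreDistinct u v w) {ι : Type*} [Finite ι]
    (P : ι → MvPolynomial (Fin 3) K) (d : ι → ℕ × ℕ × ℕ)
    (hd : ∀ i, Survives a g t (d i).1 (d i).2.1 (d i).2.2)
    (hne : ∀ i, coeff (exponent u v w (d i)) (P i) ≠ 0)
    (hz : ∀ i j, j ≠ i → coeff (exponent u v w (d i)) (P j) = 0) :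
    LinearIndependent K fun i => Ideal.Quotient.mkₐ K (symIdeal K u v w a g t) (P i) := by
  have := Fintype.ofFinite ι
  rw [Fintype.linearIndependent_iff]
  intro c hc i
  simp only [← map_smul, ← map_sum] at hc
  have hmem : ∑ i, c i • P i ∈ symIdeal K u v w a g t := Ideal.Quotient.eq_zero_iff_mem.1 hc
  have hcoeff : coeff (exponent u v w (d i)) (∑ i, c i • P i) =
      c i * coeff (exponent u v w (d i)) (P i) := by
    rw [coeff_sum, Finset.sum_eq_single i]
    · rw [coeff_smul, smul_eq_mul]
    · intro j _ hj
      rw [coeff_smul, hz i j hj, smul_zero]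
    · simp
  by_contra hci
  exact (mem_symIdeal_iff h _).1 hmem (d i) (hcoeff ▸ mul_ne_zero hci (hne i)) (hd i)

/-! ### Graded components of the quotient -/

/-- The class of the monomial with exponents `m` in the quotient by `symIdeal`. -/
noncomputable def monomialClass (K : Type*) [Field K] (u v w : Fin 3) (a g t : ℕ)
    (m : ℕ × ℕ × ℕ) : MvPolynomial (Fin 3) K ⧸ symIdeal K u v w a g t :=
  Ideal.Quotient.mkₐ K (symIdeal K u v w a g t) (monomial (exponent u v w m) 1)

theorem monomialClass_eq_zero (h : AreDistinct u v w) {m : ℕ × ℕ × ℕ}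
    (hm : ¬ Survives a g t m.1 m.2.1 m.2.2) : monomialClass K u v w a g t m = 0 := by
  refine Ideal.Quotient.eq_zero_iff_mem.2 ((mem_symIdeal_iff h _).2 fun m' hm' => ?_)
  rw [coeff_monomial] at hm'
  have : exponent u v w m = exponent u v w m' := by
    by_contra hne
    exact hm' (if_neg hne)
  rwa [← exponent_injective h this]

theorem monomialClass_ne_zero (h : AreDistinct u v w) {m : ℕ × ℕ × ℕ}
    (hm : Survives a g t m.1 m.2.1 m.2.2) : monomialClass K u v w a g t m ≠ 0 := by
  intro h0
  refine (mem_symIdeal_iff h _).1 (Ideal.Quotient.eq_zero_iff_mem.1 h0) m ?_ hm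
  rw [coeff_monomial, if_pos rfl]
  exact one_ne_zero

theorem exponent_add (u v w : Fin 3) (m m' : ℕ × ℕ × ℕ) :
    exponent u v w (m + m') = exponent u v w m + exponent u v w m' := by
  simp only [exponent, Prod.fst_add, Prod.snd_add, Finsupp.single_add]
  abel

theorem monomialClass_mul (m m' : ℕ × ℕ × ℕ) :
    monomialClass K u v w a g t m * monomialClass K u v w a g t m' =
      monomialClass K u v w a g t (m + m') := by
  rw [monomialClass, monomialClass, monomialClass, ← map_mul, monomial_mul, mul_one, exponent_add]

theorem monomialClass_mem_gradedPiece {n p q r : ℕ} (hn : p + q + r = n) :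
    monomialClass K u v w a g t (p, q, r) ∈ gradedPiece (symIdeal K u v w a g t) n := by
  refine Submodule.mem_map_of_mem ((mem_homogeneousSubmodule _ _).2 (isHomogeneous_monomial _ ?_))
  rw [degree_exponent]
  exact hn

theorem gradedPiece_eq_span (h : AreDistinct u v w) (n : ℕ) :
    gradedPiece (symIdeal K u v w a g t) n =
      Submodule.span K (monomialClass K u v w a g t '' survivors a g t n) := by
  apply le_antisymm
  · rintro _ ⟨f, hf, rfl⟩
    have hf : f.IsHomogeneous n := hf
    rw [AlgHom.toLinearMap_apply, f.as_sum, map_sum]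
    refine Submodule.sum_mem _ fun d hd => ?_
    obtain ⟨m, rfl⟩ := exponent_surjective h d
    have hdeg : m.1 + m.2.1 + m.2.2 = n := by
      rw [← degree_exponent u v w]
      by_contra hne
      exact mem_support_iff.1 hd (hf.coeff_eq_zero hne)
    rw [← mul_one (coeff _ f), ← smul_eq_mul, ← smul_monomial, map_smul]
    refine Submodule.smul_mem _ _ ?_
    by_cases hm : Survives a g t m.1 m.2.1 m.2.2
    · exact Submodule.subset_span ⟨m, mem_survivors.2 ⟨hdeg, hm⟩, rfl⟩
    · have := monomialClass_eq_zero (K := K) h hm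
      rw [monomialClass] at this
      rw [this]
      exact Submodule.zero_mem _
  · rw [Submodule.span_le]
    rintro _ ⟨⟨p, q, r⟩, hm, rfl⟩
    exact monomialClass_mem_gradedPiece (mem_survivors.1 hm).1

theorem finrank_gradedPiece (h : AreDistinct u v w) (n : ℕ) :
    Module.finrank K (gradedPiece (symIdeal K u v w a g t) n) = (survivors a g t n).card := by
  have hli := linearIndependent_mk (K := K) (a := a) (g := g) (t := t) h
    (fun m : survivors a g t n => monomial (exponent u v w m.1) (1 : K)) (fun m => m.1)
    (fun m => (mem_survivors.1 m.2).2)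
    (fun m => by rw [coeff_monomial, if_pos rfl]; exact one_ne_zero)
    (fun m m' hne => by
      rw [coeff_monomial, if_neg]
      exact fun he => hne (Subtype.ext (exponent_injective h he)))
  have := finrank_span_eq_card hli
  rw [Fintype.card_coe] at this
  rw [gradedPiece_eq_span h, Set.image_eq_range]
  exact this

theorem gradedPiece_finite (h : AreDistinct u v w) (n : ℕ) :
    Module.Finite K (gradedPiece (symIdeal K u v w a g t) n) := by
  rw [gradedPiece_eq_span h]
  exact FiniteDimensional.span_of_finite K ((Finset.finite_toSet _).image _)

theorem exists_eq_of_mem_gradedPiece_one (h : AreDistinct u v w)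
    {L : MvPolynomial (Fin 3) K ⧸ symIdeal K u v w a g t}
    (hL : L ∈ gradedPiece (symIdeal K u v w a g t) 1) :
    ∃ b c d : K, L = b • monomialClass K u v w a g t (1, 0, 0) +
      c • monomialClass K u v w a g t (0, 1, 0) + d • monomialClass K u v w a g t (0, 0, 1) := by
  have hle : gradedPiece (symIdeal K u v w a g t) 1 ≤ Submodule.span K
      {monomialClass K u v w a g t (1, 0, 0), monomialClass K u v w a g t (0, 1, 0),
        monomialClass K u v w a g t (0, 0, 1)} := by
    rw [gradedPiece_eq_span h, Submodule.span_le]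
    rintro _ ⟨⟨p, q, r⟩, hm, rfl⟩
    have hm := (mem_survivors.1 hm).1
    apply Submodule.subset_span
    have : (p = 1 ∧ q = 0 ∧ r = 0) ∨ (p = 0 ∧ q = 1 ∧ r = 0) ∨ (p = 0 ∧ q = 0 ∧ r = 1) := by
      omega
    rcases this with ⟨rfl, rfl, rfl⟩ | ⟨rfl, rfl, rfl⟩ | ⟨rfl, rfl, rfl⟩ <;> simp
  obtain ⟨b, c, d, e⟩ := Submodule.mem_span_triple.1 (hle hL)
  exact ⟨b, c, d, e.symm⟩

/-! ### Twisted orbit sums -/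

/-- The orbit sum of `X u ^ (q + k) * X v ^ q * X w ^ r`, twisted by the coefficients `b`, `c` of
a linear form `b • X u + c • X v + d • X w`: for `m = (q, k, r)` with `k ≠ 0` it is
`b ^ k • X u ^ (q + k) * X v ^ q * X w ^ r + c ^ k • X u ^ q * X v ^ (q + k) * X w ^ r`, and for
`k = 0` it is the single monomial `X u ^ q * X v ^ q * X w ^ r`. Up to a factor `(b * c) ^ q` it is
what the substitution `X u ↦ b • X u`, `X v ↦ c • X v` makes of an ordinary orbit sum; without that
factor it stays nonzero when one of `b`, `c` vanishes. -/
noncomputable def orbitSum (u v w : Fin 3) (b c : K) (m : ℕ × ℕ × ℕ) :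
    MvPolynomial (Fin 3) K :=
  if m.2.1 = 0 then monomial (exponent u v w (m.1, m.1, m.2.2)) 1
  else monomial (exponent u v w (m.1 + m.2.1, m.1, m.2.2)) (b ^ m.2.1) +
    monomial (exponent u v w (m.1, m.1 + m.2.1, m.2.2)) (c ^ m.2.1)

/-- The class of `orbitSum u v w b c m` in the quotient by `symIdeal`. -/
noncomputable def orbitClass (u v w : Fin 3) (a g t : ℕ) (b c : K) (m : ℕ × ℕ × ℕ) :
    MvPolynomial (Fin 3) K ⧸ symIdeal K u v w a g t :=
  Ideal.Quotient.mkₐ K (symIdeal K u v w a g t) (orbitSum u v w b c m)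

theorem orbitClass_zero (b c : K) (q r : ℕ) :
    orbitClass u v w a g t b c (q, 0, r) = monomialClass K u v w a g t (q, q, r) := by
  rw [orbitClass, orbitSum, if_pos rfl, monomialClass]

theorem orbitClass_succ (b c : K) (q k r : ℕ) :
    orbitClass u v w a g t b c (q, k + 1, r) =
      b ^ (k + 1) • monomialClass K u v w a g t (q + (k + 1), q, r) +
      c ^ (k + 1) • monomialClass K u v w a g t (q, q + (k + 1), r) := by
  rw [orbitClass, orbitSum, if_neg (Nat.succ_ne_zero k), monomialClass, monomialClass,
    ← map_smul _ (b ^ (k + 1)), ← map_smul _ (c ^ (k + 1)), ← map_add, smul_monomial,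
    smul_monomial, smul_eq_mul, smul_eq_mul, mul_one, mul_one]

theorem survives_swap {p q r : ℕ} : Survives a g t p q r ↔ Survives a g t q p r := by
  unfold Survives
  omega

theorem orbitClass_eq_zero (h : AreDistinct u v w) (b c : K) {q k r : ℕ}
    (hm : ¬ Survives a g t (q + k) q r) : orbitClass u v w a g t b c (q, k, r) = 0 := by
  rcases k with _ | k
  · rw [orbitClass_zero]
    exact monomialClass_eq_zero h hm
  · rw [orbitClass_succ, monomialClass_eq_zero h hm,
      monomialClass_eq_zero h (fun h' => hm (survives_swap.1 h')), smul_zero, smul_zero, add_zero]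

theorem orbitClass_mem_gradedPiece (b c : K) {n q k r : ℕ} (hn : 2 * q + k + r = n) :
    orbitClass u v w a g t b c (q, k, r) ∈ gradedPiece (symIdeal K u v w a g t) n := by
  rcases k with _ | k
  · rw [orbitClass_zero]
    exact monomialClass_mem_gradedPiece (by omega)
  · rw [orbitClass_succ]
    exact add_mem (Submodule.smul_mem _ _ (monomialClass_mem_gradedPiece (by omega)))
      (Submodule.smul_mem _ _ (monomialClass_mem_gradedPiece (by omega)))

theorem orbitClass_mem_span (h : AreDistinct u v w) (b c : K) {n q k r : ℕ}
    (hn : 2 * q + k + r = n) :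
    orbitClass u v w a g t b c (q, k, r) ∈
      Submodule.span K (orbitClass u v w a g t b c '' survivorOrbits a g t n) := by
  by_cases hm : Survives a g t (q + k) q r
  · exact Submodule.subset_span ⟨_, mem_survivorOrbits.2 ⟨hn, hm⟩, rfl⟩
  · rw [orbitClass_eq_zero h b c hm]
    exact Submodule.zero_mem _

/-- The classes of the twisted orbit sums of surviving orbits are linearly independent: at least one
of the two monomials of each orbit keeps a nonzero coefficient, `b ^ k` or `c ^ k`. -/
theorem orbitClass_linearIndependent (h : AreDistinct u v w) {b c : K} (hbc : b ≠ 0 ∨ c ≠ 0)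
    (n : ℕ) :
    LinearIndependent K fun m : survivorOrbits a g t n =>
      orbitClass u v w a g t b c m.1 := by
  rcases hbc with hb | hc
  · refine linearIndependent_mk h (fun m : survivorOrbits a g t n => orbitSum u v w b c m.1)
      (fun m => (m.1.1 + m.1.2.1, m.1.1, m.1.2.2)) (fun m => (mem_survivorOrbits.1 m.2).2) ?_ ?_
    · rintro ⟨⟨q, k, r⟩, hm⟩
      rcases k with _ | k
      · simp [orbitSum]
      · simp [orbitSum, (exponent_injective h).eq_iff, hb]
    · rintro ⟨⟨q, k, r⟩, hm⟩ ⟨⟨q', k', r'⟩, hm'⟩ hne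
      simp only [ne_eq, Subtype.mk.injEq, Prod.mk.injEq] at hne
      dsimp only [orbitSum]
      split_ifs with hk
      · rw [coeff_monomial, if_neg]
        rw [(exponent_injective h).eq_iff, Prod.mk.injEq, Prod.mk.injEq]
        omega
      · rw [coeff_add, coeff_monomial, coeff_monomial, if_neg, if_neg, add_zero]
        all_goals
          rw [(exponent_injective h).eq_iff, Prod.mk.injEq, Prod.mk.injEq]
          omega
  · refine linearIndependent_mk h (fun m : survivorOrbits a g t n => orbitSum u v w b c m.1)
      (fun m => (m.1.1, m.1.1 + m.1.2.1, m.1.2.2))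
      (fun m => survives_swap.1 (mem_survivorOrbits.1 m.2).2) ?_ ?_
    · rintro ⟨⟨q, k, r⟩, hm⟩
      rcases k with _ | k
      · simp [orbitSum]
      · simp [orbitSum, (exponent_injective h).eq_iff, hc]
    · rintro ⟨⟨q, k, r⟩, hm⟩ ⟨⟨q', k', r'⟩, hm'⟩ hne
      simp only [ne_eq, Subtype.mk.injEq, Prod.mk.injEq] at hne
      dsimp only [orbitSum]
      split_ifs with hk
      · rw [coeff_monomial, if_neg]
        rw [(exponent_injective h).eq_iff, Prod.mk.injEq, Prod.mk.injEq]
        omega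
      · rw [coeff_add, coeff_monomial, coeff_monomial, if_neg, if_neg, add_zero]
        all_goals
          rw [(exponent_injective h).eq_iff, Prod.mk.injEq, Prod.mk.injEq]
          omega

/-- Multiplication by a linear form preserves the span of the orbit sums twisted by its own
coefficients. -/
theorem mul_orbitClass_mem_span (h : AreDistinct u v w) (b c d : K) {n q k r : ℕ}
    (hn : 2 * q + k + r + 1 = n) :
    (b • monomialClass K u v w a g t (1, 0, 0) + c • monomialClass K u v w a g t (0, 1, 0) +
        d • monomialClass K u v w a g t (0, 0, 1)) * orbitClass u v w a g t b c (q, k, r) ∈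
      Submodule.span K (orbitClass u v w a g t b c '' survivorOrbits a g t n) := by
  rcases k with _ | _ | k
  · have : (b • monomialClass K u v w a g t (1, 0, 0) +
        c • monomialClass K u v w a g t (0, 1, 0) + d • monomialClass K u v w a g t (0, 0, 1)) *
        orbitClass u v w a g t b c (q, 0, r) =
        orbitClass u v w a g t b c (q, 0 + 1, r) +
        d • orbitClass u v w a g t b c (q, 0, r + 1) := by
      simp only [orbitClass_succ, orbitClass_zero, add_mul, smul_mul_assoc, monomialClass_mul,
        Prod.mk_add_mk, zero_add, pow_one, add_comm 1]
    rw [this]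
    exact add_mem (orbitClass_mem_span h b c (by omega))
      (Submodule.smul_mem _ _ (orbitClass_mem_span h b c (by omega)))
  · have : (b • monomialClass K u v w a g t (1, 0, 0) +
        c • monomialClass K u v w a g t (0, 1, 0) + d • monomialClass K u v w a g t (0, 0, 1)) *
        orbitClass u v w a g t b c (q, 0 + 1, r) =
        orbitClass u v w a g t b c (q, (0 + 1) + 1, r) +
        (2 * b * c) • orbitClass u v w a g t b c (q + 1, 0, r) +
        d • orbitClass u v w a g t b c (q, 0 + 1, r + 1) := by
      simp only [orbitClass_succ, orbitClass_zero, add_mul, mul_add, smul_mul_assoc,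
        mul_smul_comm, monomialClass_mul, Prod.mk_add_mk, zero_add, pow_one, add_comm 1, add_assoc]
      module
    rw [this]
    exact add_mem (add_mem (orbitClass_mem_span h b c (by omega))
      (Submodule.smul_mem _ _ (orbitClass_mem_span h b c (by omega))))
      (Submodule.smul_mem _ _ (orbitClass_mem_span h b c (by omega)))
  · have : (b • monomialClass K u v w a g t (1, 0, 0) +
        c • monomialClass K u v w a g t (0, 1, 0) + d • monomialClass K u v w a g t (0, 0, 1)) *
        orbitClass u v w a g t b c (q, (k + 1) + 1, r) =
        orbitClass u v w a g t b c (q, (k + 1 + 1) + 1, r) +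
        (b * c) • orbitClass u v w a g t b c (q + 1, k + 1, r) +
        d • orbitClass u v w a g t b c (q, (k + 1) + 1, r + 1) := by
      have e1 : 1 + (q + (k + 1 + 1)) = q + (k + 1 + 1 + 1) := by omega
      have e2 : q + 1 + (k + 1) = q + (k + 1 + 1) := by omega
      simp only [orbitClass_succ, add_mul, mul_add, smul_mul_assoc,
        mul_smul_comm, monomialClass_mul, Prod.mk_add_mk, zero_add, e1, e2, add_comm 1 q,
        add_comm 1 r]
      module
    rw [this]
    exact add_mem (add_mem (orbitClass_mem_span h b c (by omega))
      (Submodule.smul_mem _ _ (orbitClass_mem_span h b c (by omega))))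
      (Submodule.smul_mem _ _ (orbitClass_mem_span h b c (by omega)))

/-! ### Failure of maximal rank -/

/-- Between spaces whose dimensions do not decrease, maximal rank means injectivity. -/
theorem eq_zero_of_mul_eq_zero {A : Type*} [CommRing A] [Algebra K A] (V W : Submodule K A)
    [Module.Finite K V] [Module.Finite K W] (hVW : Module.finrank K V ≤ Module.finrank K W)
    {L : A} (hL : Set.InjOn (fun x => L * x) (V : Set A) ∨
      Set.SurjOn (fun x => L * x) (V : Set A) (W : Set A)) {x : A} (hx : x ∈ V)
    (h0 : L * x = 0) : x = 0 := by
  rcases hL with hL | hL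
  · exact hL hx V.zero_mem (by simpa using h0)
  · set f := (LinearMap.mulLeft K L).domRestrict V with hf
    have hle : W ≤ LinearMap.range f := by
      intro y hy
      obtain ⟨x, hx, rfl⟩ := hL hy
      exact ⟨⟨x, hx⟩, rfl⟩
    have h1 := Submodule.finrank_mono hle
    have h2 := LinearMap.finrank_range_add_finrank_ker f
    have hker : LinearMap.ker f = ⊥ := Submodule.finrank_eq_zero.1 (by omega)
    have : (⟨x, hx⟩ : V) ∈ LinearMap.ker f := h0
    rw [hker, Submodule.mem_bot] at this
    exact congrArg Subtype.val this

/-- The common form of the three families: `s` is the mean of the exponents `a`, `a`, `g`. -/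
theorem not_hasWLP_symIdeal (h : AreDistinct u v w) {s : ℕ} (ha : 1 ≤ a) (hg : 1 ≤ g)
    (hs : 3 * s = 2 * a + g) (hgs : g < 2 * s) (hst : s < t) (hsodd : Odd s) (ht : Even t) :
    ¬ HasWLP (symIdeal K u v w a g t) := by
  rintro ⟨L, hL, hmax⟩
  obtain ⟨b, c, d, rfl⟩ := exists_eq_of_mem_gradedPiece_one h hL
  set L := b • monomialClass K u v w a g t (1, 0, 0) + c • monomialClass K u v w a g t (0, 1, 0) +
        d • monomialClass K u v w a g t (0, 0, 1) with hLdef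
  have hj : 2 * s + t - 2 + 1 = 2 * s + t - 1 := by omega
  have := gradedPiece_finite (K := K) (a := a) (g := g) (t := t) h (2 * s + t - 2)
  have := gradedPiece_finite (K := K) (a := a) (g := g) (t := t) h (2 * s + t - 1)
  have hmax := hmax (2 * s + t - 2)
  rw [hj] at hmax
  have hinj : ∀ x ∈ gradedPiece (symIdeal K u v w a g t) (2 * s + t - 2), L * x = 0 → x = 0 :=
    fun x hx => eq_zero_of_mul_eq_zero _ _ (by
      rw [finrank_gradedPiece h, finrank_gradedPiece h, card_survivors_eq ha hg hs hgs hst])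
      hmax hx
  by_cases hbc : b ≠ 0 ∨ c ≠ 0
  -- Multiplication by `L` cannot embed the twisted orbit sums of degree `2 * s + t - 2` into the
  -- span of those of the next degree, since there are fewer of them.
  · have hli := orbitClass_linearIndependent (a := a) (g := g) (t := t) h hbc (2 * s + t - 2)
    have hli' : LinearIndependent K fun m : survivorOrbits a g t (2 * s + t - 2) =>
        L * orbitClass u v w a g t b c m.1 := by
      rw [Fintype.linearIndependent_iff] at hli ⊢
      intro e he
      refine hli e (hinj _ (Submodule.sum_mem _ fun m _ => Submodule.smul_mem _ _ ?_) ?_)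
      · exact orbitClass_mem_gradedPiece b c (mem_survivorOrbits.1 m.2).1
      · rw [Finset.mul_sum, ← he]
        simp only [mul_smul_comm]
    have hle : Submodule.span K (Set.range fun m : survivorOrbits a g t (2 * s + t - 2) =>
        L * orbitClass u v w a g t b c m.1) ≤ Submodule.span K
          (orbitClass u v w a g t b c '' survivorOrbits a g t (2 * s + t - 1)) := by
      rw [Submodule.span_le]
      rintro _ ⟨⟨⟨q, k, r⟩, hm⟩, rfl⟩
      have hm := (mem_survivorOrbits.1 hm).1
      exact mul_orbitClass_mem_span h b c d (by omega)
    classical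
    rw [← Finset.coe_image] at hle
    have h1 := Submodule.finrank_mono hle
    rw [finrank_span_eq_card hli', Fintype.card_coe] at h1
    have h2 := finrank_span_finset_le_card (R := K)
      ((survivorOrbits a g t (2 * s + t - 1)).image (orbitClass u v w a g t b c))
    have h3 := Finset.card_image_le (s := survivorOrbits a g t (2 * s + t - 1))
      (f := orbitClass u v w a g t b c)
    have h4 := card_survivorOrbits_eq ha hg hs hgs hst hsodd ht
    rw [Set.finrank] at h2
    omega
  · push Not at hbc
    obtain ⟨rfl, rfl⟩ := hbc
    -- `L` is a multiple of `X w`, which kills every monomial divisible by `X w ^ (g + t - 1)`.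
    refine monomialClass_ne_zero (K := K) (a := a) (g := g) (t := t)
      (m := (2 * s - g - 1, 0, g + t - 1)) h ?_ (hinj _ ?_ ?_)
    · unfold Survives
      dsimp only
      omega
    · exact monomialClass_mem_gradedPiece (by omega)
    · rw [hLdef, zero_smul, zero_smul, zero_add, zero_add, smul_mul_assoc, monomialClass_mul,
        monomialClass_eq_zero h, smul_zero]
      unfold Survives
      simp only [Prod.mk_add_mk]
      omega

end

theorem corollary6p4 {K : Type*} [Field K] (α β γ t : ℕ)
    (hα : 1 ≤ α) (hαβ : α ≤ β) (hβγ : β ≤ γ)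
    (h :
      (Even α ∧ β = α ∧ Even t ∧
        ∃ l : ℕ, Odd l ∧ 1 ≤ l ∧ l ≤ α ∧ γ = α + 3 * l ∧ α + l ≤ t) ∨
      (Odd α ∧ β = α ∧ Even t ∧
        ∃ m : ℕ, 2 * m ≤ α - 1 ∧ γ = α + 6 * m ∧ α + 2 * m ≤ t) ∨
      (Odd α ∧ Even t ∧
        ∃ r : ℕ, β = α + 3 * r ∧ γ = α + 3 * r ∧ α + 2 * r ≤ t)) :
    ¬ HasWLP (levelIdeal K α β γ t) := by
  rcases h with ⟨hα2, rfl, ht, l, hl, -, hlα, rfl, hlt⟩ | ⟨hα2, rfl, ht, m, hm, rfl, hmt⟩ |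
    ⟨hα2, ht, r, rfl, rfl, hrt⟩
  · have hs : Odd (β + l) := hα2.add_odd hl
    -- The parities exclude the boundary values `t = s` and `γ = 2 * s`.
    have hne : β + l ≠ t := fun e => Nat.not_even_iff_odd.2 hs (e ▸ ht)
    have hne' : β ≠ l := fun e => Nat.not_even_iff_odd.2 hl (e ▸ hα2)
    exact not_hasWLP_symIdeal (u := 0) (v := 1) (w := 2) ⟨by decide, by decide, by decide⟩ hα
      (by omega) (s := β + l) (by omega) (by omega) (by omega) hs ht
  · have hs : Odd (β + 2 * m) := hα2.add_even (even_two_mul m)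
    have hne : β + 2 * m ≠ t := fun e => Nat.not_even_iff_odd.2 hs (e ▸ ht)
    exact not_hasWLP_symIdeal (u := 0) (v := 1) (w := 2) ⟨by decide, by decide, by decide⟩ hα
      (by omega) (s := β + 2 * m) (by omega) (by omega) (by omega) hs ht
  · have hs : Odd (α + 2 * r) := hα2.add_even (even_two_mul r)
    have hne : α + 2 * r ≠ t := fun e => Nat.not_even_iff_odd.2 hs (e ▸ ht)
    have hI : levelIdeal K α (α + 3 * r) (α + 3 * r) t = symIdeal K 1 2 0 (α + 3 * r) α t := by
      rw [levelIdeal, symIdeal]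
      congr 1
      rw [mul_assoc, mul_comm (X 0 ^ α : MvPolynomial (Fin 3) K)]
      ext f
      simp only [Set.mem_insert_iff, Set.mem_singleton_iff]
      tauto
    rw [hI]
    exact not_hasWLP_symIdeal ⟨by decide, by decide, by decide⟩ (by omega) hα
      (s := α + 2 * r) (by omega) (by omega) (by omega) hs ht
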